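/- For positive integers $u,v$ let $$P(u,v,x)=\sum_{j=0}^{u}\frac{(u+v-j)!}{v!}\binom{u}{j}x^{j},\qquad Q(u,v,x)=\sum_{j=0}^{v}\frac{(u+v-j)!}{u!}\binom{v}{j}(-x)^{j}$$ be the normalized numerator and denominator of the $(u,v)$-Padé approximant to the exponential. Let $p$ be an odd prime. Then: (1) Each of the polynomials $P(p+1,p+2,x)$ and $Q(p,p+1,x)$ is either irreducible over $\mathbf{Q}$ or the product of a linear polynomial and an irreducible polynomial of degree $p$ over $\mathbf{Q}$. (2) For $P(p+1,p+2,x)$ the latter case occurs if and only if there exists an integer $m$ such that $P(p+1,p+2,-3+pm)=0$. For $Q(p,p+1,x)$ the latter case occurs if and only if there exists an integer $m$ such that $Q(p,p+1,-1+pm)=0$; it also occurs if and only if there exists an integer $m$ such that $Q(p,p+1,1+pm)=0$. -/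

import Mathlib

/-- The normalized Padé numerator of the exponential,
`P(u,v,x) = ∑_{j=0}^{u} (u+v-j)!/v! * binom(u,j) * x^j`, as a polynomial over `ℚ`. -/
noncomputable def padeP (u v : ℕ) : Polynomial ℚ :=
  ∑ j ∈ Finset.range (u + 1),
    Polynomial.C (((u + v - j).factorial : ℚ) / (v.factorial : ℚ) * (u.choose j : ℚ)) *
      Polynomial.X ^ j

/-- The normalized Padé denominator of the exponential,
`Q(u,v,x) = ∑_{j=0}^{v} (u+v-j)!/u! * binom(v,j) * (-x)^j`, as a polynomial over `ℚ`. -/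
noncomputable def padeQ (u v : ℕ) : Polynomial ℚ :=
  ∑ j ∈ Finset.range (v + 1),
    Polynomial.C (((u + v - j).factorial : ℚ) / (u.factorial : ℚ) * (v.choose j : ℚ)) *
      (-Polynomial.X) ^ j

/-- `F` is the product of a linear polynomial and an irreducible polynomial of degree `d`
over `ℚ`. -/
def IsLinearMulIrreducible (F : Polynomial ℚ) (d : ℕ) : Prop :=
  ∃ f g : Polynomial ℚ, F = f * g ∧ f.natDegree = 1 ∧ Irreducible g ∧ g.natDegree = d

open Polynomial

/-! Since p + 1 is even, P(p+1,v,x) is, up to a positive factor, the integral over t > 0 of t^v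
(x+t)^(p+1) e^(-t), hence positive for every rational x; Q(p,p+1,x) = P(p+1,p,-x). So neither
polynomial has a rational root: the linear-factor case and the root conditions are both impossible,
and the equivalences hold as false iff false. Irreducibility comes from Eisenstein's argument with
one degree missing: it forces any factorization to have a factor of degree at most 1, and degree 1
would give a root. -/

/-- The Padé numerator with integer coefficients. -/
noncomputable def padePInt (u v : ℕ) : ℤ[X] :=
  ∑ j ∈ Finset.range (u + 1), C (((v + 1).ascFactorial (u - j) * u.choose j : ℕ) : ℤ) * X ^ j

theorem padePInt_coeff (u v j : ℕ) :
    (padePInt u v).coeff j = (((v + 1).ascFactorial (u - j) * u.choose j : ℕ) : ℤ) := by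
  simp only [padePInt, finsetSum_coeff, coeff_C_mul, coeff_X_pow, mul_ite, mul_one, mul_zero,
    Finset.sum_ite_eq, Finset.mem_range]
  split_ifs with h
  · rfl
  · rw [Nat.choose_eq_zero_of_lt (by omega)]
    simp

theorem padePInt_natDegree_le (u v : ℕ) : (padePInt u v).natDegree ≤ u := by
  rw [natDegree_le_iff_coeff_eq_zero]
  intro j hj
  rw [padePInt_coeff, Nat.choose_eq_zero_of_lt hj]
  simp

theorem padePInt_monic (u v : ℕ) : (padePInt u v).Monic :=
  monic_of_natDegree_le_of_coeff_eq_one u (padePInt_natDegree_le u v) (by simp [padePInt_coeff])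

theorem padePInt_natDegree (u v : ℕ) : (padePInt u v).natDegree = u :=
  le_antisymm (padePInt_natDegree_le u v) (le_natDegree_of_ne_zero (by simp [padePInt_coeff]))

theorem padePInt_map (u v : ℕ) : (padePInt u v).map (algebraMap ℤ ℚ) = padeP u v := by
  simp only [padePInt, padeP, Polynomial.map_sum, Polynomial.map_mul, Polynomial.map_pow, map_X,
    map_C]
  refine Finset.sum_congr rfl fun j hj => ?_
  have hj' : j ≤ u := Nat.lt_succ_iff.mp (Finset.mem_range.mp hj)
  have h := Nat.factorial_mul_ascFactorial v (u - j)
  rw [show v + (u - j) = u + v - j by omega] at h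
  congr 2
  rw [← h]
  have := Nat.cast_ne_zero (R := ℚ).mpr v.factorial_ne_zero
  push_cast
  field_simp

/-- The denominator is the reflected numerator with the parameters exchanged. -/
theorem padeQ_eq_comp (u v : ℕ) : padeQ u v = (padeP v u).comp (-X) := by
  rw [padeP, comp, eval₂_finsetSum]
  simp only [padeQ, eval₂_mul, eval₂_C, eval₂_X_pow, add_comm u v]

open MeasureTheory in
/-- `v! * P(u,v,x) = ∫ t in (0,∞), t^v (t+x)^u e^{-t}`, hence `P(u,v,x) > 0` for even `u`. -/
theorem eval_padeP_pos {u : ℕ} (hu : Even u) (v : ℕ) (x : ℚ) : 0 < (padeP u v).eval x := by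
  have hG (n : ℕ) : IntegrableOn (fun t : ℝ => Real.exp (-t) * t ^ n) (Set.Ioi 0) ∧
      ∫ t in Set.Ioi (0 : ℝ), Real.exp (-t) * t ^ n = n.factorial := by
    have h1 := Real.GammaIntegral_convergent (s := n + 1) (by positivity)
    have h2 := Real.Gamma_eq_integral (s := n + 1) (by positivity)
    rw [Real.Gamma_nat_eq_factorial] at h2
    simp only [add_sub_cancel_right, Real.rpow_natCast] at h1 h2
    exact ⟨h1, h2.symm⟩
  have hexp (t : ℝ) : Real.exp (-t) * t ^ v * (x + t) ^ u =
      ∑ j ∈ Finset.range (u + 1), (x : ℝ) ^ j * u.choose j * (Real.exp (-t) * t ^ (u + v - j)) := by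
    rw [add_pow, Finset.mul_sum]
    refine Finset.sum_congr rfl fun j hj => ?_
    have hj' : j ≤ u := Nat.lt_succ_iff.mp (Finset.mem_range.mp hj)
    rw [show u + v - j = v + (u - j) by omega, pow_add]
    ring
  have hint : IntegrableOn (fun t : ℝ => Real.exp (-t) * t ^ v * (x + t) ^ u) (Set.Ioi 0) := by
    simp only [hexp]
    exact integrable_finsetSum _ fun j _ => (hG _).1.const_mul _
  have hval : ∫ t in Set.Ioi (0 : ℝ), Real.exp (-t) * t ^ v * (x + t) ^ u =
      v.factorial * ((padeP u v).eval x : ℚ) := by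
    simp only [hexp]
    rw [integral_finsetSum _ fun j _ => (hG _).1.const_mul _]
    simp only [integral_const_mul, (hG _).2, padeP, eval_finsetSum, eval_mul, eval_C, eval_pow,
      eval_X]
    push_cast
    rw [Finset.mul_sum]
    refine Finset.sum_congr rfl fun j _ => ?_
    have := Nat.cast_ne_zero (R := ℝ).mpr v.factorial_ne_zero
    field_simp
  have hpos : 0 < ∫ t in Set.Ioi (0 : ℝ), Real.exp (-t) * t ^ v * (x + t) ^ u := by
    rw [setIntegral_pos_iff_support_of_nonneg_ae _ hint]
    -- The factor `(x + t) ^ u` may vanish at `t = -x`; beyond `max 0 (-x)` the integrand is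
    -- nonzero.
    · refine lt_of_lt_of_le ?_ (measure_mono (s := Set.Ioi (max 0 (-(x : ℝ)))) ?_)
      · simp
      · intro t ht
        obtain ⟨h0, h1⟩ := max_lt_iff.mp (Set.mem_Ioi.mp ht)
        have h2 : 0 < (x : ℝ) + t := by linarith
        exact ⟨by simp only [Function.mem_support]; positivity, h0⟩
    · filter_upwards [ae_restrict_mem measurableSet_Ioi] with t ht
      have h0 : 0 < t := ht
      exact mul_nonneg (by positivity) (hu.pow_nonneg _)
  rw [hval] at hpos
  exact_mod_cast pos_of_mul_pos_right hpos (by positivity)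

/-- If the coefficients of `f * g` in degrees below `n` vanish modulo a prime and `g 0` does not, then
`X ^ n` divides `f` modulo that prime, so `f` has degree at least `n`. -/
theorem natDegree_ge_of_dvd_coeff_mul {q : ℕ} (hq : q.Prime) {n : ℕ} {f g : ℤ[X]} (hf : f.Monic)
    (hdvd : ∀ j < n, (q : ℤ) ∣ (f * g).coeff j) (hg : ¬ (q : ℤ) ∣ g.coeff 0) :
    n ≤ f.natDegree := by
  have : Fact q.Prime := ⟨hq⟩
  let φ := Int.castRingHom (ZMod q)
  have h1 : (X : (ZMod q)[X]) ^ n ∣ f.map φ * g.map φ := by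
    rw [← Polynomial.map_mul, X_pow_dvd_iff]
    intro j hj
    rw [coeff_map, eq_intCast, ZMod.intCast_zmod_eq_zero_iff_dvd _ q]
    exact hdvd j hj
  have h2 : ¬ (X : (ZMod q)[X]) ∣ g.map φ := by
    rw [X_dvd_iff, coeff_map, eq_intCast, ZMod.intCast_zmod_eq_zero_iff_dvd _ q]
    exact hg
  have h3 : (X : (ZMod q)[X]) ^ n ∣ f.map φ :=
    prime_X.pow_dvd_of_dvd_mul_right n h2 h1
  have h4 := natDegree_le_of_dvd h3 (hf.map φ).ne_zero
  rwa [natDegree_X_pow, hf.natDegree_map] at h4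

theorem exists_root_of_natDegree_eq_one {F f g : ℚ[X]} (h : F = f * g) (hf : f.natDegree = 1) :
    ∃ x, F.eval x = 0 := by
  obtain ⟨x, hx⟩ := exists_root_of_degree_eq_one
    (degree_eq_iff_natDegree_eq_of_pos one_pos |>.mpr hf)
  exact ⟨x, by rw [h, eval_mul, hx.eq_zero, zero_mul]⟩

/-- A monic polynomial of degree `n + 1` that satisfies Eisenstein's conditions in degrees below
`n` and has no rational root is irreducible. -/
theorem irreducible_map_of_eisenstein_of_no_root {q : ℕ} (hq : q.Prime) {n : ℕ} {F : ℤ[X]}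
    (hF : F.Monic) (hdeg : F.natDegree = n + 1) (hdvd : ∀ j < n, (q : ℤ) ∣ F.coeff j)
    (h0 : ¬ (q : ℤ) ^ 2 ∣ F.coeff 0)
    (hroot : ∀ x : ℚ, (F.map (algebraMap ℤ ℚ)).eval x ≠ 0) :
    Irreducible (F.map (algebraMap ℤ ℚ)) := by
  have key (f g : ℤ[X]) (hf : f.Monic) (hg : g.Monic) (hfg : f * g = F)
      (hg0 : ¬ (q : ℤ) ∣ g.coeff 0) : g.natDegree = 0 := by
    have h1 := natDegree_ge_of_dvd_coeff_mul hq hf (by rwa [hfg]) hg0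
    have h2 : f.natDegree + g.natDegree = n + 1 := by rw [← hf.natDegree_mul hg, hfg, hdeg]
    by_contra h3
    obtain ⟨x, hx⟩ := exists_root_of_natDegree_eq_one (F := F.map (algebraMap ℤ ℚ))
      (f := g.map (algebraMap ℤ ℚ)) (g := f.map (algebraMap ℤ ℚ))
      (by rw [← hfg, Polynomial.map_mul, mul_comm]) (by rw [hg.natDegree_map]; omega)
    exact hroot x hx
  rw [← hF.irreducible_iff_irreducible_map_fraction_map, hF.irreducible_iff_natDegree]
  refine ⟨fun h => by simp [h] at hdeg, fun f g hf hg hfg => ?_⟩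
  -- As `q ^ 2` does not divide `F.coeff 0`, some factor has constant term prime to `q`; that factor
  -- is trivial.
  by_cases hg0 : (q : ℤ) ∣ g.coeff 0
  · refine Or.inl (key g f hg hf (by rw [mul_comm, hfg]) fun hf0 => h0 ?_)
    rw [← hfg, mul_coeff_zero, sq]
    exact mul_dvd_mul hf0 hg0
  · exact Or.inr (key f g hf hg hfg hg0)

theorem irreducible_padeP_of_eisenstein {q : ℕ} (hq : q.Prime) {n v : ℕ} (hn : Odd n)
    (hdvd : ∀ j < n, q ∣ (v + 1).ascFactorial (n + 1 - j) * (n + 1).choose j)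
    (h0 : ¬ q ^ 2 ∣ (v + 1).ascFactorial (n + 1)) : Irreducible (padeP (n + 1) v) := by
  rw [← padePInt_map]
  refine irreducible_map_of_eisenstein_of_no_root hq (padePInt_monic _ _) (padePInt_natDegree _ _)
    (fun j hj => ?_) ?_ fun x => ?_
  · rw [padePInt_coeff]
    exact_mod_cast hdvd j hj
  · rw [padePInt_coeff]
    simp only [Nat.sub_zero, Nat.choose_zero_right, mul_one]
    exact_mod_cast h0
  · rw [padePInt_map]
    exact (eval_padeP_pos hn.add_one v x).ne'

theorem dvd_ascFactorial {m n k : ℕ} (h1 : n ≤ m) (h2 : m < n + k) : m ∣ n.ascFactorial k := by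
  rw [Nat.ascFactorial_eq_prod_range]
  have h := Finset.dvd_prod_of_mem (fun i => n + i)
    (Finset.mem_range.mpr (show m - n < k by omega))
  rwa [Nat.add_sub_cancel' h1] at h

/-- The product runs over an interval strictly between p and 3p, so 2p is its only multiple of p,
and p is odd. -/
theorem not_sq_dvd_ascFactorial {p : ℕ} (hp : p.Prime) (hodd : Odd p) {n k : ℕ} (h1 : p < n)
    (h2 : n ≤ 2 * p) (h3 : 2 * p < n + k) (h4 : n + k ≤ 3 * p) :
    ¬ p ^ 2 ∣ n.ascFactorial k := by
  rw [Nat.ascFactorial_eq_prod_range,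
    ← Finset.mul_prod_erase _ _ (Finset.mem_range.mpr (show 2 * p - n < k by omega)),
    show n + (2 * p - n) = p * 2 by omega, sq, mul_assoc, Nat.mul_dvd_mul_iff_left hp.pos,
    hp.dvd_mul, hp.prime.dvd_finsetProd_iff]
  rintro (h | ⟨i, hi, c, hc⟩)
  · rw [Nat.prime_dvd_prime_iff_eq hp Nat.prime_two] at h
    subst h
    exact absurd hodd (by decide)
  · rw [Finset.mem_erase, Finset.mem_range] at hi
    have hc1 : 1 < c := by
      by_contra! h
      have := Nat.mul_le_mul_left p h
      omega
    have hc3 : c < 3 := by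
      by_contra! h
      have := Nat.mul_le_mul_left p h
      omega
    obtain rfl : c = 2 := by omega
    omega

/-- The bounds on `v` place 2p, but neither p nor 3p, among v+1, ..., v+p+1. -/
theorem irreducible_padeP_prime {p : ℕ} (hp : p.Prime) (hodd : Odd p) {v : ℕ} (h1 : p ≤ v)
    (h2 : v + 1 < 2 * p) : Irreducible (padeP (p + 1) v) := by
  refine irreducible_padeP_of_eisenstein hp hodd (fun j hj => ?_)
    (not_sq_dvd_ascFactorial hp hodd (by omega) (by omega) (by omega) (by omega))
  -- For j = 0, 1 the rising factorial contains 2p; from j = 2 on, p divides the binomial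
  -- coefficient, by Pascal's rule.
  rcases j with _ | _ | j
  · exact (((Nat.dvd_mul_left p 2).trans (dvd_ascFactorial (by omega) (by omega)))).mul_right _
  · exact (((Nat.dvd_mul_left p 2).trans (dvd_ascFactorial (by omega) (by omega)))).mul_right _
  · refine Dvd.dvd.mul_left ?_ _
    rw [Nat.choose_succ_succ]
    exact dvd_add (hp.dvd_choose_self (by omega) (by omega))
      (hp.dvd_choose_self (by omega) (by omega))

/-- For p = 3 the constant term 6·7·8·9 is divisible by 9, so the prime 7 replaces 3. -/
theorem irreducible_padeP_four_five : Irreducible (padeP (3 + 1) (3 + 2)) := by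
  refine irreducible_padeP_of_eisenstein (q := 7) (by norm_num) (by decide) (fun j hj => ?_)
    (by decide)
  interval_cases j <;> decide

theorem irreducible_padeP_succ_add_two {p : ℕ} (hp : p.Prime) (hodd : Odd p) :
    Irreducible (padeP (p + 1) (p + 2)) := by
  have h2 := hp.two_le
  obtain ⟨k, hk⟩ := hodd
  rcases eq_or_ne p 3 with rfl | h3
  · exact irreducible_padeP_four_five
  · exact irreducible_padeP_prime hp ⟨k, hk⟩ (by omega) (by omega)

theorem irreducible_padeQ_succ {p : ℕ} (hp : p.Prime) (hodd : Odd p) :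
    Irreducible (padeQ p (p + 1)) := by
  have h2 := hp.two_le
  obtain ⟨k, hk⟩ := hodd
  have h := irreducible_padeP_prime hp ⟨k, hk⟩ le_rfl (by omega)
  rw [padeQ_eq_comp]
  exact (MulEquiv.irreducible_iff (algEquivAevalNegX (R := ℚ))).mpr h

theorem not_isLinearMulIrreducible_of_no_root {F : ℚ[X]} (h : ∀ x, F.eval x ≠ 0) (d : ℕ) :
    ¬ IsLinearMulIrreducible F d := by
  rintro ⟨f, g, hfg, hf, -, -⟩
  obtain ⟨x, hx⟩ := exists_root_of_natDegree_eq_one hfg hf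
  exact h x hx

theorem mainTheorem5 (p : ℕ) (hp : p.Prime) (hodd : Odd p) :
    (Irreducible (padeP (p + 1) (p + 2)) ∨ IsLinearMulIrreducible (padeP (p + 1) (p + 2)) p) ∧
    (Irreducible (padeQ p (p + 1)) ∨ IsLinearMulIrreducible (padeQ p (p + 1)) p) ∧
    (IsLinearMulIrreducible (padeP (p + 1) (p + 2)) p ↔
      ∃ m : ℤ, (padeP (p + 1) (p + 2)).eval (-3 + (p : ℚ) * (m : ℚ)) = 0) ∧
    (IsLinearMulIrreducible (padeQ p (p + 1)) p ↔
      ∃ m : ℤ, (padeQ p (p + 1)).eval (-1 + (p : ℚ) * (m : ℚ)) = 0) ∧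
    (IsLinearMulIrreducible (padeQ p (p + 1)) p ↔
      ∃ m : ℤ, (padeQ p (p + 1)).eval (1 + (p : ℚ) * (m : ℚ)) = 0) := by
  have hP (x : ℚ) : (padeP (p + 1) (p + 2)).eval x ≠ 0 :=
    (eval_padeP_pos hodd.add_one _ x).ne'
  have hQ (x : ℚ) : (padeQ p (p + 1)).eval x ≠ 0 := by
    rw [padeQ_eq_comp, eval_comp]
    exact (eval_padeP_pos hodd.add_one _ _).ne'
  refine ⟨Or.inl (irreducible_padeP_succ_add_two hp hodd), Or.inl (irreducible_padeQ_succ hp hodd),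
    iff_of_false (not_isLinearMulIrreducible_of_no_root hP p) ?_,
    iff_of_false (not_isLinearMulIrreducible_of_no_root hQ p) ?_,
    iff_of_false (not_isLinearMulIrreducible_of_no_root hQ p) ?_⟩
  · rintro ⟨m, hm⟩
    exact hP _ hm
  · rintro ⟨m, hm⟩
    exact hQ _ hm
  · rintro ⟨m, hm⟩
    exact hQ _ hm
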